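/- Let $M$ be a smooth ($\sigma$-compact, Hausdorff) manifold of dimension $n\ge 1$ with boundary $\partial M$, and let $g_0$ be a smooth Riemannian metric on $M$. For $t>0$ put $M_t=\{x\in M : d_{g_0}(x,\partial M)<t\}$. Let $t_0>0$ be any number for which the normal exponential map $(x,t)\mapsto \exp_x(t\,\nu(x))$, where $\nu$ is the inward $g_0$-unit normal of $\partial M$, is defined on $\partial M\times[0,t_0)$ and is a diffeomorphism from $\partial M\times[0,t_0)$ onto $M_{t_0}$. Then there is a smooth function $\phi: M\to[1,\infty)$ such that 1. $\partial M$ is convex with respect to the conformal metric $\widetilde g_0=\phi g_0$, in the strict sense: the second fundamental form $A_{\widetilde g_0}(v,w)=\widetilde g_0(\widetilde\nabla_v W,\widetilde\nu)$ of $\partial M$ ($\widetilde\nu$ the inward $\widetilde g_0$-unit normal, $\widetilde\nabla$ the Levi-Civita connection of $\widetilde g_0$, $W$ any vector field tangent to $\partial M$ along $\partial M$ that extends $w$) is positive definite at every point of $\partial M$; 2. $\phi=1$ on $M\setminus M_{t_0}$. -/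

import Mathlib

open scoped Manifold ContDiff Bundle ENNReal
open Set Bundle

noncomputable section

namespace BoundaryConvexity

variable {n : ℕ} [NeZero n] {M : Type*} [TopologicalSpace M]
  [ChartedSpace (EuclideanHalfSpace n) M] [IsManifold (𝓡∂ n) ∞ M]

/-- Smooth Riemannian metrics on the smooth `n`-dimensional manifold with boundary `M`
(smooth up to and including the boundary). -/
abbrev Metric (n : ℕ) [NeZero n] (M : Type*) [TopologicalSpace M]
    [ChartedSpace (EuclideanHalfSpace n) M] [IsManifold (𝓡∂ n) ∞ M] : Type _ :=
  ContMDiffRiemannianMetric (𝓡∂ n) ∞ (EuclideanSpace ℝ (Fin n))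
    (fun x : M => TangentSpace (𝓡∂ n) x)

/-- The conformal metric `φ g`, for a smooth positive function `φ`. -/
def Metric.conformal (g : Metric n M) (φ : M → ℝ) (hφ : ContMDiff (𝓡∂ n) 𝓘(ℝ, ℝ) ∞ φ)
    (hpos : ∀ x, 0 < φ x) : Metric n M where
  inner x := φ x • g.inner x
  symm x v w := by
    change φ x * g.inner x v w = φ x * g.inner x w v
    rw [g.symm x v w]
  pos x v hv := mul_pos (hpos x) (g.pos x v hv)
  isVonNBounded x := by
    have hs : 0 < Real.sqrt (φ x) := Real.sqrt_pos.2 (hpos x)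
    refine ((g.isVonNBounded x).image ((Real.sqrt (φ x))⁻¹ •
      ContinuousLinearMap.id ℝ (TangentSpace (𝓡∂ n) x))).subset ?_
    intro v hv
    refine ⟨Real.sqrt (φ x) • v, ?_, ?_⟩
    · change φ x * g.inner x v v < 1 at hv
      change g.inner x (Real.sqrt (φ x) • v) (Real.sqrt (φ x) • v) < 1
      rw [map_smul, map_smul]
      change Real.sqrt (φ x) * (Real.sqrt (φ x) * g.inner x v v) < 1
      rwa [← mul_assoc, Real.mul_self_sqrt (hpos x).le]
    · change (Real.sqrt (φ x))⁻¹ • (Real.sqrt (φ x) • v) = v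
      rw [smul_smul, inv_mul_cancel₀ hs.ne', one_smul]
  contMDiff := ContMDiff.smul_section (V := fun x : M => TangentSpace (𝓡∂ n) x →L[ℝ]
    (TangentSpace (𝓡∂ n) x →L[ℝ] ℝ)) hφ g.contMDiff

/-- The Riemannian distance of `g`: the infimum of the `g`-lengths of the `C¹` paths from `x`
to `y` (`∞` if there is none). -/
def Metric.edist (g : Metric n M) (x y : M) : ℝ≥0∞ :=
  letI : RiemannianBundle (fun x : M => TangentSpace (𝓡∂ n) x) := ⟨g.toRiemannianMetric⟩
  Manifold.riemannianEDist (𝓡∂ n) x y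

/-- `M_t = {x : d_g(x, ∂M) < t}`. -/
def boundaryNhd (g : Metric n M) (t : ℝ) : Set M :=
  {x | (⨅ y ∈ (𝓡∂ n).boundary M, g.edist x y) < ENNReal.ofReal t}

/-- The tangent vector, at the point of `M` with coordinate `y` in the preferred chart at `x`, with
given constant coordinates in this chart. -/
def chartVec (x : M) (y : EuclideanSpace ℝ (Fin n)) :
    EuclideanSpace ℝ (Fin n) →L[ℝ] TangentSpace (𝓡∂ n) ((extChartAt (𝓡∂ n) x).symm y) :=
  mfderivWithin 𝓘(ℝ, EuclideanSpace ℝ (Fin n)) (𝓡∂ n)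
    (extChartAt (𝓡∂ n) x).symm (range (𝓡∂ n)) y

/-- The coefficient `g(v, w)` of the metric in the preferred chart at `x`, as a function of the
chart coordinate `y`; here `v`, `w` are constant coordinate vectors. -/
def metricCoord (g : Metric n M) (x : M) (v w : EuclideanSpace ℝ (Fin n))
    (y : EuclideanSpace ℝ (Fin n)) : ℝ :=
  g.inner ((extChartAt (𝓡∂ n) x).symm y) (chartVec x y v) (chartVec x y w)

/-- The derivative at (the coordinate of) `x` of the coefficient `g(v, w)` in the direction `u`,
in the preferred chart at `x`. -/
def dMetricCoord (g : Metric n M) (x : M) (u v w : EuclideanSpace ℝ (Fin n)) : ℝ :=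
  fderivWithin ℝ (metricCoord g x v w) (range (𝓡∂ n)) (extChartAt (𝓡∂ n) x x) u

/-- Christoffel symbols of the first kind at `x`, in the preferred chart at `x`: for constant
coordinate vectors `u`, `v`, `w`, the number `g(∇ᵤ v, w)`, where `∇` is the Levi-Civita
connection of `g`. -/
def christoffel (g : Metric n M) (x : M) (u v w : EuclideanSpace ℝ (Fin n)) : ℝ :=
  (dMetricCoord g x u v w + dMetricCoord g x v u w - dMetricCoord g x w u v) / 2

/-- The coordinates of a tangent vector at `x` in the preferred chart at `x`. For `x ∈ ∂M`, this
chart sends `∂M` to the hyperplane `{y | y 0 = 0}` and `M` to the half-space `{y | 0 ≤ y 0}`, so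
that `v` is tangent to `∂M` iff `coordVec x v 0 = 0`, and it points inward iff
`0 < coordVec x v 0`. -/
def coordVec (x : M) : TangentSpace (𝓡∂ n) x →L[ℝ] EuclideanSpace ℝ (Fin n) :=
  mfderiv (𝓡∂ n) 𝓘(ℝ, EuclideanSpace ℝ (Fin n)) (extChartAt (𝓡∂ n) x) x

/-- For `x ∈ ∂M`: `ν` is the inward `g`-unit vector normal to `∂M` at `x`. -/
structure IsInwardUnitNormal (g : Metric n M) (x : M) (ν : TangentSpace (𝓡∂ n) x) : Prop where
  unit : g.inner x ν ν = 1
  normal : ∀ v : TangentSpace (𝓡∂ n) x, coordVec x v 0 = 0 → g.inner x ν v = 0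
  inward : 0 < coordVec x ν 0

theorem exists_isInwardUnitNormal (g : Metric n M) (x : M) :
    ∃ ν : TangentSpace (𝓡∂ n) x, IsInwardUnitNormal g x ν := by
  have : FiniteDimensional ℝ (TangentSpace (𝓡∂ n) x) :=
    inferInstanceAs (FiniteDimensional ℝ (EuclideanSpace ℝ (Fin n)))
  let L : TangentSpace (𝓡∂ n) x →ₗ[ℝ] ℝ :=
    (EuclideanSpace.proj (0 : Fin n) : EuclideanSpace ℝ (Fin n) →L[ℝ] ℝ).toLinearMap ∘ₗ
      (coordVec x).toLinearMap
  have hL : ∀ v, L v = coordVec x v 0 := fun v => rfl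
  let B : TangentSpace (𝓡∂ n) x →ₗ[ℝ] Module.Dual ℝ (TangentSpace (𝓡∂ n) x) :=
    { toFun := fun v => (g.inner x v).toLinearMap
      map_add' := fun v w => by ext u; simp
      map_smul' := fun c v => by ext u; simp }
  have hB : ∀ v w, B v w = g.inner x v w := fun v w => rfl
  have hinj : Function.Injective B := by
    rw [injective_iff_map_eq_zero]
    intro v hv
    by_contra h
    have := g.pos x v h
    rw [← hB, hv] at this
    simp at this
  have hsurj : Function.Surjective B :=
    (LinearMap.injective_iff_surjective_of_finrank_eq_finrank
      Subspace.dual_finrank_eq.symm).1 hinj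
  obtain ⟨u, hu⟩ := hsurj L
  have hu' : ∀ v, g.inner x u v = coordVec x v 0 := fun v => by rw [← hB, hu, hL]
  have hu0 : u ≠ 0 := by
    rintro rfl
    obtain ⟨e, he⟩ := (isInvertible_mfderiv_extChartAt (I := 𝓡∂ n)
      (mem_extChartAt_source (I := 𝓡∂ n) x))
    have h1 := hu' (e.symm (EuclideanSpace.single 0 1))
    have h2 : coordVec x (e.symm (EuclideanSpace.single 0 1)) =
        EuclideanSpace.single (0 : Fin n) (1 : ℝ) := by
      unfold coordVec
      rw [← he]
      exact e.apply_symm_apply _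
    rw [h2] at h1
    simp at h1
  have hpos := g.pos x u hu0
  have hs : 0 < Real.sqrt (g.inner x u u) := Real.sqrt_pos.2 hpos
  have hss := Real.mul_self_sqrt hpos.le
  refine ⟨(Real.sqrt (g.inner x u u))⁻¹ • u, ?_, ?_, ?_⟩
  · simp only [map_smul, smul_apply, smul_eq_mul]
    rw [← mul_assoc, ← mul_inv, hss, inv_mul_cancel₀ hpos.ne']
  · intro v hv
    simp only [map_smul, smul_apply, smul_eq_mul]
    rw [hu' v, hv, mul_zero]
  · rw [map_smul, PiLp.smul_apply, ← hu', smul_eq_mul]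
    exact mul_pos (inv_pos.2 hs) hpos

/-- The inward unit normal `ν` of `∂M` with respect to `g` (meaningful for `x ∈ ∂M`). -/
def inwardUnitNormal (g : Metric n M) (x : M) : TangentSpace (𝓡∂ n) x :=
  Classical.choose (exists_isInwardUnitNormal g x)

/-- The second fundamental form `A(v, w) = g(∇ᵥ W, ν)` of `∂M` at `x ∈ ∂M` with respect to the
inward unit normal `ν`, for `v`, `w` tangent to `∂M` at `x`. The extension `W` of `w` to a vector
field tangent to `∂M` is the one with constant coordinates in the preferred chart at `x`, in which
`∂M` is the hyperplane `{y | y 0 = 0}`. With this sign the form is positive definite for a round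
ball in Euclidean space, and `2 A` is minus the restriction to `∂M` of the Lie derivative of `g`
along any vector field extending `ν`. -/
def secondFundamentalForm (g : Metric n M) (x : M) (v w : TangentSpace (𝓡∂ n) x) : ℝ :=
  christoffel g x (coordVec x v) (coordVec x w) (coordVec x (inwardUnitNormal g x))

/-- `∂M` is (strictly) convex with respect to `g`: its second fundamental form with respect to the
inward unit normal is positive definite at every point of `∂M`. -/
def HasConvexBoundary (g : Metric n M) : Prop :=
  ∀ x ∈ (𝓡∂ n).boundary M, ∀ v : TangentSpace (𝓡∂ n) x, coordVec x v 0 = 0 → v ≠ 0 →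
    0 < secondFundamentalForm g x v v

/-- `γ` is a geodesic of `g` on `[0, T)`: it is smooth there and `g(∇_{γ'} γ', u) = 0` at every
time `s` and for every `u`, where `∇_{γ'} γ' = c'' + Γ(c', c')` is computed with the coordinate
expression `c` of `γ` in the preferred chart at `γ s` (derivatives at `0` are one-sided). -/
def IsGeodesic (g : Metric n M) (T : ℝ) (γ : ℝ → M) : Prop :=
  ContMDiffOn 𝓘(ℝ, ℝ) (𝓡∂ n) ∞ γ (Ico 0 T) ∧
  ∀ s ∈ Ico 0 T, ∀ u : EuclideanSpace ℝ (Fin n),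
    let c : ℝ → EuclideanSpace ℝ (Fin n) := fun r => extChartAt (𝓡∂ n) (γ s) (γ r)
    let c' := derivWithin c (Ico 0 T) s
    let c'' := iteratedDerivWithin 2 c (Ico 0 T) s
    metricCoord g (γ s) c'' u (c s) + christoffel g (γ s) c' c' u = 0

/-- `E` is the normal exponential map of `∂M` on `∂M × [0, T)`: for `x ∈ ∂M`, the curve
`t ↦ E (x, t) = exp_x (t ν)` is the geodesic on `[0, T)` that starts at `x` with initial velocity
the inward unit normal `ν`. -/
def IsNormalExp (g : Metric n M) (T : ℝ) (E : M × ℝ → M) : Prop :=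
  ∀ x ∈ (𝓡∂ n).boundary M,
    E (x, 0) = x ∧
    mfderivWithin 𝓘(ℝ, ℝ) (𝓡∂ n) (fun t : ℝ => E (x, t)) (Ico 0 T) 0 (1 : ℝ) =
      inwardUnitNormal g (E (x, 0)) ∧
    IsGeodesic g T (fun t => E (x, t))

/-- The normal exponential map is defined on `∂M × [0, t)` and is a diffeomorphism from it
onto `M_t`. The manifold `∂M × [0, t)` is regarded as a subset of `M × ℝ`, and a map from or to
it is smooth iff it is so as a map from a subset of, or to, `M × ℝ`. -/
def IsNormalCollar (g : Metric n M) (t : ℝ) : Prop :=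
  ∃ (E : M × ℝ → M) (F : M → M × ℝ), IsNormalExp g t E ∧
    InvOn F E ((𝓡∂ n).boundary M ×ˢ Ico 0 t) (boundaryNhd g t) ∧
    MapsTo E ((𝓡∂ n).boundary M ×ˢ Ico 0 t) (boundaryNhd g t) ∧
    MapsTo F (boundaryNhd g t) ((𝓡∂ n).boundary M ×ˢ Ico 0 t) ∧
    ContMDiffOn ((𝓡∂ n).prod 𝓘(ℝ, ℝ)) (𝓡∂ n) ∞ E ((𝓡∂ n).boundary M ×ˢ Ico 0 t) ∧
    ContMDiffOn (𝓡∂ n) ((𝓡∂ n).prod 𝓘(ℝ, ℝ)) ∞ F (boundaryNhd g t)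

end BoundaryConvexity

end

/-! The mechanism is the conformal change formula. For `u` tangent and `w` normal to `∂M`, the
Christoffel term `g(∇ᵤ u, w)` of `φ g` equals `φ` times that of `g` minus `dφ(w) g(u, u) / 2`
(`christoffel_conformal`). If `φ = 2` on `∂M` and `φ` decreases inward fast enough, the last term
dominates and the form becomes positive definite.

Take `φ = 1 + χ exp (-θ)`. Here `χ` is a cutoff with values in `[0, 1]`, equal to `1` on `∂M` and
`0` outside the interior of the prescribed neighbourhood; `θ` vanishes on `∂M` and grows inward at
least like `K y₀`, with `y₀` the defining coordinate of `∂M` in a chart. The exponential keeps `φ ≥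
1`. The bound `φ ≤ 1 + exp (-θ)`, an equality on `∂M`, already bounds the inward derivative of `φ`
by that of `exp (-K y₀)`, so derivatives of `χ` and `θ` never have to be computed
(`fderivWithin_comp_symm_le`).

Without compactness, `K` can only be chosen locally: near each `p` one constant works
(`exists_eventually_christoffel_pos`), and bump functions assemble these rates into `θ`
(`exists_contMDiff_boundary_growth`). Since the second fundamental form at `x` is written in the
preferred chart at `x`, which need not vary continuously with `x`, it must be transported to the
fixed chart at `p`; this is `christoffel_eq_chartChange`. The set `M_{t₀}` enters as a neighbourhood
of `∂M`. -/

noncomputable section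

namespace BoundaryConvexity

set_option maxSynthPendingDepth 3

/-! ### Calculus and linear algebra in a normed space. -/

section Calculus

open Filter Topology

variable {V : Type*} [NormedAddCommGroup V] [NormedSpace ℝ V]

/-- A one-sided derivative at a local minimum, in a direction pointing into the set, is
nonnegative. -/
theorem hasFDerivWithinAt_nonneg_of_eventually_le {h : V → ℝ} {h' : V →L[ℝ] ℝ}
    {s : Set V} {z w : V} (hs : Convex ℝ s) (hz : z ∈ s) (hw : z + w ∈ s) (hd : HasFDerivWithinAt h h' s z)
    (hmin : ∀ᶠ y in 𝓝[s] z, h z ≤ h y) : 0 ≤ h' w :=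
  IsLocalMinOn.hasFDerivWithinAt_nonneg hmin hd
    (mem_posTangentConeAt_of_segment_subset (hs.segment_subset hz hw))

/-- If `ℓ ∘ σ` vanishes along a line contained in `s`, then so does the `ℓ`-component of the second
derivative of `σ` in the direction of this line. -/
theorem apply_secondDeriv_eq_zero {σ : V → V} {σ' : V → V →L[ℝ] V}
    {σ'' : V →L[ℝ] V →L[ℝ] V} {s : Set V} {z v : V} (ℓ : V →L[ℝ] ℝ)
    (hline : ∀ t : ℝ, z + t • v ∈ s) (hσ : ∀ᶠ y in 𝓝[s] z, HasFDerivWithinAt σ (σ' y) s y)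
    (hσ' : HasFDerivWithinAt σ' σ'' s z)
    (hzero : ∀ᶠ y in 𝓝[s] z, ∀ t : ℝ, y = z + t • v → ℓ (σ y) = 0) :
    ℓ (σ'' v v) = 0 := by
  have hc : ∀ t : ℝ, HasDerivAt (fun t : ℝ => z + t • v) v t := fun t => by
    simpa using ((hasDerivAt_id t).smul_const v).const_add z
  have htend : Tendsto (fun t : ℝ => z + t • v) (𝓝 0) (𝓝[s] z) := by
    refine tendsto_nhdsWithin_iff.2 ⟨?_, Eventually.of_forall hline⟩
    simpa using (hc 0).continuousAt.tendsto
  have h0 : ∀ᶠ t : ℝ in 𝓝 0, ℓ (σ (z + t • v)) = 0 := by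
    filter_upwards [htend.eventually hzero] with t ht using ht t rfl
  -- Differentiating once must give zero for all `t` near `0`, not only at `0`, so that a second
  -- differentiation is possible.
  have h1 : ∀ᶠ t : ℝ in 𝓝 0, ℓ (σ' (z + t • v) v) = 0 := by
    filter_upwards [h0.eventually_nhds, htend.eventually hσ] with t ht hd
    have hd' : HasDerivAt (fun t : ℝ => ℓ (σ (z + t • v))) (ℓ (σ' (z + t • v) v)) t :=
      (ℓ.hasFDerivAt.comp_hasDerivAt t
        ((hd.comp_hasDerivWithinAt (s := univ) t (hc t).hasDerivWithinAt
          (fun r _ => hline r)).hasDerivAt univ_mem))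
    have he : (fun t : ℝ => ℓ (σ (z + t • v))) =ᶠ[𝓝 t] fun _ => 0 := ht
    exact hd'.unique ((hasDerivAt_const t (0 : ℝ)).congr_of_eventuallyEq he)
  have hσ0 : HasFDerivWithinAt σ' σ'' s (z + (0 : ℝ) • v) := by simpa using hσ'
  have h2 : HasDerivAt (fun t : ℝ => σ' (z + t • v)) (σ'' v) 0 :=
    (hσ0.comp_hasDerivWithinAt (s := univ) (0 : ℝ) (hc 0).hasDerivWithinAt
      (fun r _ => hline r)).hasDerivAt univ_mem
  have h3 : HasDerivAt (fun t : ℝ => ℓ (σ' (z + t • v) v)) (ℓ (σ'' v v)) 0 := by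
    have := ℓ.hasFDerivAt.comp_hasDerivAt (0 : ℝ) (h2.clm_apply (hasDerivAt_const (0 : ℝ) v))
    simpa [Function.comp_def] using this
  exact h3.unique ((hasDerivAt_const (0 : ℝ) (0 : ℝ)).congr_of_eventuallyEq h1)

/-- A positive definite bilinear form depending continuously on a parameter is locally uniformly
positive definite. -/
theorem exists_eventually_le_of_posDef [FiniteDimensional ℝ V] {G : V → V →L[ℝ] V →L[ℝ] ℝ}
    {s : Set V} {y₀ : V} (hG : ContinuousWithinAt G s y₀) (hpos : ∀ a, a ≠ 0 → 0 < G y₀ a a) :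
    ∃ c > 0, ∀ᶠ y in 𝓝[s] y₀, ∀ a, c * ‖a‖ ^ 2 ≤ G y a a := by
  obtain ⟨m, hm, hm'⟩ : ∃ m > 0, ∀ a, m * ‖a‖ ^ 2 ≤ G y₀ a a := by
    -- The constant is the minimum of the quadratic form over the compact unit sphere, which is
    -- empty when `V` is trivial.
    rcases (_root_.Metric.sphere (0 : V) 1).eq_empty_or_nonempty with he | hne
    · refine ⟨1, one_pos, fun a => ?_⟩
      have : a = 0 := by
        by_contra ha
        have : (‖a‖⁻¹ • a) ∈ _root_.Metric.sphere (0 : V) 1 := by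
          simp [norm_smul, inv_mul_cancel₀ (norm_ne_zero_iff.2 ha)]
        simp [he] at this
      simp [this]
    · obtain ⟨a₀, ha₀, hmin⟩ := (isCompact_sphere (0 : V) 1).exists_isMinOn hne
        (f := fun a => G y₀ a a) (by fun_prop)
      refine ⟨G y₀ a₀ a₀, hpos _ (by rintro rfl; simp at ha₀), fun a => ?_⟩
      by_cases ha : a = 0
      · simp [ha]
      have hn := norm_pos_iff.2 ha
      have h1 : G y₀ a₀ a₀ ≤ G y₀ (‖a‖⁻¹ • a) (‖a‖⁻¹ • a) :=
        hmin (by simp [norm_smul, inv_mul_cancel₀ hn.ne'])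
      simp only [map_smul, smul_apply, smul_eq_mul] at h1
      calc G y₀ a₀ a₀ * ‖a‖ ^ 2 ≤ (‖a‖⁻¹ * (‖a‖⁻¹ * G y₀ a a)) * ‖a‖ ^ 2 := by gcongr
        _ = G y₀ a a := by field_simp
  refine ⟨m / 2, by positivity, ?_⟩
  have := _root_.Metric.tendsto_nhds.1 hG (m / 2) (by positivity)
  filter_upwards [this] with y hy a
  rw [dist_eq_norm] at hy
  have h2 : |(G y - G y₀) a a| ≤ m / 2 * ‖a‖ * ‖a‖ := by
    refine (((G y - G y₀).le_opNorm₂ a a)).trans ?_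
    gcongr
  have h3 := hm' a
  simp only [sub_apply] at h2
  nlinarith [(abs_le.1 h2).1]

/-- A sufficiently large multiple of the metric `G` dominates the Christoffel symbols
in the direction of vectors `b` that are `G`-normal to the hyperplane `ℓ = 0`, locally uniformly. -/
theorem exists_eventually_christoffel_pos [FiniteDimensional ℝ V] {G : V → V →L[ℝ] V →L[ℝ] ℝ}
    {G' : V → V →L[ℝ] V →L[ℝ] V →L[ℝ] ℝ} {s : Set V} {y₀ : V}
    (hG : ContinuousWithinAt G s y₀) (hG' : ContinuousWithinAt G' s y₀)
    (hpos : ∀ a, a ≠ 0 → 0 < G y₀ a a) (ℓ : V →L[ℝ] ℝ) {e : V} (he : ℓ e = 1) :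
    ∃ K > 0, ∀ᶠ y in 𝓝[s] y₀, ∀ a b, a ≠ 0 → 0 < ℓ b → (∀ v, ℓ v = 0 → G y b v = 0) →
      0 < 2 * ((G' y a a b + G' y a a b - G' y b a a) / 2) + K / 2 * ℓ b * G y a a := by
  obtain ⟨c, hc, hc'⟩ := exists_eventually_le_of_posDef hG hpos
  set C := max (‖G y₀‖ + 1) (‖G' y₀‖ + 1)
  have hC : 0 < C := lt_max_of_lt_left (by positivity)
  have h1 : ∀ᶠ y in 𝓝[s] y₀, ‖G y‖ < C :=
    hG.norm.eventually (gt_mem_nhds (lt_max_of_lt_left (lt_add_one _)))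
  have h2 : ∀ᶠ y in 𝓝[s] y₀, ‖G' y‖ < C :=
    hG'.norm.eventually (gt_mem_nhds (lt_max_of_lt_right (lt_add_one _)))
  -- The Christoffel part is at least `-3C‖a‖²‖b‖`, and `‖b‖ ≤ (C‖e‖/c) ℓ b` for normal `b`. Half of
  -- this `K`, times the lower bound `c`, is the resulting coefficient plus `1`; the extra `1` gives
  -- strictness.
  refine ⟨2 * (3 * C * (C * ‖e‖ / c) + 1) / c, by positivity, ?_⟩
  filter_upwards [hc', h1, h2] with y hy hy1 hy2 a b ha hb hn
  have hna := norm_pos_iff.2 ha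
  have hb0 : b ≠ 0 := by rintro rfl; simp at hb
  have hnb := norm_pos_iff.2 hb0
  -- Normality of `b`, tested on `b - ℓ b • e` in the kernel of `ℓ`, is what makes `ℓ b` control the
  -- full norm of `b`.
  have hbb : G y b b = ℓ b * G y b e := by
    have := hn (b - ℓ b • e) (by simp [he])
    simp only [map_sub, map_smul, smul_eq_mul] at this
    linarith
  have hbe : G y b e ≤ C * ‖b‖ * ‖e‖ :=
    (le_abs_self _).trans (((G y).le_opNorm₂ b e).trans (by gcongr))
  have hb1 : ‖b‖ ≤ C * ‖e‖ / c * ℓ b := by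
    have h3 : c * ‖b‖ ^ 2 ≤ ℓ b * (C * ‖b‖ * ‖e‖) :=
      (hy b).trans (hbb.le.trans (by gcongr))
    have h4 : c * ‖b‖ ≤ ℓ b * (C * ‖e‖) := by
      refine le_of_mul_le_mul_right ?_ hnb
      linarith
    rw [div_mul_eq_mul_div, le_div_iff₀ hc]
    linarith
  have hT : ∀ u v w, |G' y u v w| ≤ C * ‖u‖ * ‖v‖ * ‖w‖ := fun u v w =>
    ((G' y u).le_opNorm₂ v w).trans (by gcongr; exact ((G' y).le_opNorm u).trans (by gcongr))
  have e1 := (abs_le.1 (hT a a b)).1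
  have e2 := (abs_le.1 (hT b a a)).2
  have e3 : 3 * C * ‖a‖ ^ 2 * ‖b‖ ≤ 3 * C * ‖a‖ ^ 2 * (C * ‖e‖ / c * ℓ b) := by gcongr
  have e4 : 2 * (3 * C * (C * ‖e‖ / c) + 1) / c / 2 * ℓ b * (c * ‖a‖ ^ 2) ≤
      2 * (3 * C * (C * ‖e‖ / c) + 1) / c / 2 * ℓ b * G y a a := by
    gcongr
    exact hy a
  have e5 : 2 * (3 * C * (C * ‖e‖ / c) + 1) / c / 2 * ℓ b * (c * ‖a‖ ^ 2) =
      3 * C * ‖a‖ ^ 2 * (C * ‖e‖ / c * ℓ b) + ℓ b * ‖a‖ ^ 2 := by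
    field_simp
  have e6 : 0 < ℓ b * ‖a‖ ^ 2 := by positivity
  nlinarith

end Calculus

/-! ### Boundary charts, changes of coordinates and the metric tensor. -/

section Manifold

open Filter Topology

variable {n : ℕ} [NeZero n] {M : Type*} [TopologicalSpace M]
  [ChartedSpace (EuclideanHalfSpace n) M]

theorem mem_range_halfSpace_iff {y : EuclideanSpace ℝ (Fin n)} : y ∈ range (𝓡∂ n) ↔ 0 ≤ y 0 := by
  rw [range_modelWithCornersEuclideanHalfSpace]; rfl

theorem extChartAt_mem_range (p q : M) : extChartAt (𝓡∂ n) p q ∈ range (𝓡∂ n) :=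
  mem_range_self _

/-- The change of coordinates from the preferred chart at `a` to the preferred chart at `b`. -/
abbrev chartChange (a b : M) : EuclideanSpace ℝ (Fin n) → EuclideanSpace ℝ (Fin n) :=
  extChartAt (𝓡∂ n) b ∘ (extChartAt (𝓡∂ n) a).symm

/-- The derivative of the change of coordinates between preferred charts. -/
abbrev chartChangeDeriv (a b : M) (y : EuclideanSpace ℝ (Fin n)) :
    EuclideanSpace ℝ (Fin n) →L[ℝ] EuclideanSpace ℝ (Fin n) :=
  fderivWithin ℝ (chartChange a b) (range (𝓡∂ n)) y

theorem chartChange_extChartAt {a q : M} (b : M) (ha : q ∈ (extChartAt (𝓡∂ n) a).source) :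
    chartChange a b (extChartAt (𝓡∂ n) a q) = extChartAt (𝓡∂ n) b q :=
  congrArg (extChartAt (𝓡∂ n) b) ((extChartAt (𝓡∂ n) a).left_inv ha)

theorem chartChange_mapsTo (a b : M) :
    MapsTo (chartChange a b) (range (𝓡∂ n)) (range (𝓡∂ n)) :=
  fun _ _ => extChartAt_mem_range b _

theorem eventually_mem_overlap {a b q : M} (ha : q ∈ (extChartAt (𝓡∂ n) a).source)
    (hb : q ∈ (extChartAt (𝓡∂ n) b).source) :
    ∀ᶠ y in 𝓝[range (𝓡∂ n)] (extChartAt (𝓡∂ n) a q), y ∈ (extChartAt (𝓡∂ n) a).target ∧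
      (extChartAt (𝓡∂ n) a).symm y ∈ (extChartAt (𝓡∂ n) b).source := by
  refine Eventually.and (extChartAt_target_mem_nhdsWithin' ha) ?_
  have hc := continuousAt_extChartAt_symm' (I := 𝓡∂ n) ha
  have : (extChartAt (𝓡∂ n) b).source ∈
      𝓝 ((extChartAt (𝓡∂ n) a).symm (extChartAt (𝓡∂ n) a q)) := by
    rw [(extChartAt (𝓡∂ n) a).left_inv ha]
    exact (isOpen_extChartAt_source b).mem_nhds hb
  exact mem_nhdsWithin_of_mem_nhds (hc.preimage_mem_nhds this)

variable [IsManifold (𝓡∂ n) ∞ M]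

/-- Being an interior point can be tested in any chart of the atlas, and a chart target is
relatively open in the half-space, so its interior points are those with positive coordinate `0`. -/
theorem mem_boundary_iff_extChartAt_apply_zero {p q : M} (hq : q ∈ (extChartAt (𝓡∂ n) p).source) :
    q ∈ (𝓡∂ n).boundary M ↔ extChartAt (𝓡∂ n) p q 0 = 0 := by
  have hq' : q ∈ (chartAt (EuclideanHalfSpace n) p).source := by rwa [extChartAt_source] at hq
  have ht := (extChartAt (𝓡∂ n) p).map_source hq
  have hint := (𝓡∂ n).isInteriorPoint_iff_of_mem_atlas (n := ∞) (by simp)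
    (chart_mem_atlas (EuclideanHalfSpace n) p) hq'
  change _ ↔ extChartAt (𝓡∂ n) p q ∈ interior (extChartAt (𝓡∂ n) p).target at hint
  have hnn : 0 ≤ extChartAt (𝓡∂ n) p q 0 := mem_range_halfSpace_iff.1 (extChartAt_mem_range p q)
  change (𝓡∂ n).IsBoundaryPoint q ↔ _
  rw [(𝓡∂ n).isBoundaryPoint_iff_not_isInteriorPoint, hint, not_iff_comm]
  constructor
  · intro h
    have hpos : 0 < extChartAt (𝓡∂ n) p q 0 := lt_of_le_of_ne hnn (Ne.symm h)
    have : extChartAt (𝓡∂ n) p q ∈ interior (range (𝓡∂ n)) := by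
      rw [interior_range_modelWithCornersEuclideanHalfSpace]; exact hpos
    have h2 := extChartAt_target_mem_nhdsWithin_of_mem ht
    rw [mem_interior_iff_mem_nhds] at this ⊢
    rwa [nhdsWithin_eq_nhds.2 this] at h2
  · intro h h0
    have := interior_mono (extChartAt_target_subset_range (I := 𝓡∂ n) p) h
    rw [interior_range_modelWithCornersEuclideanHalfSpace] at this
    exact (show 0 < extChartAt (𝓡∂ n) p q 0 from this).ne' h0

/-- The metric tensor in the preferred chart at `p`, as a function with values in bilinear forms. -/
def metricForm (g : Metric n M) (p : M) (y : EuclideanSpace ℝ (Fin n)) :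
    EuclideanSpace ℝ (Fin n) →L[ℝ] EuclideanSpace ℝ (Fin n) →L[ℝ] ℝ :=
  ContinuousLinearMap.bilinearComp (E := EuclideanSpace ℝ (Fin n)) (F := EuclideanSpace ℝ (Fin n))
    (E' := EuclideanSpace ℝ (Fin n)) (F' := EuclideanSpace ℝ (Fin n))
    (g.inner ((extChartAt (𝓡∂ n) p).symm y)) (chartVec p y) (chartVec p y)

theorem metricForm_apply (g : Metric n M) (p : M) (y v w : EuclideanSpace ℝ (Fin n)) :
    metricForm g p y v w = metricCoord g p v w y := rfl

theorem metricForm_symm (g : Metric n M) (p : M) (y v w : EuclideanSpace ℝ (Fin n)) :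
    metricForm g p y v w = metricForm g p y w v := g.symm _ _ _

theorem metricForm_pos (g : Metric n M) {p : M} {y v : EuclideanSpace ℝ (Fin n)}
    (hy : y ∈ (extChartAt (𝓡∂ n) p).target) (hv : v ≠ 0) : 0 < metricForm g p y v v := by
  refine g.pos _ _ fun h => hv ?_
  have := mfderiv_extChartAt_comp_mfderivWithin_extChartAt_symm (I := 𝓡∂ n) hy
  have h2 := DFunLike.congr_fun this v
  refine h2.symm.trans ?_
  change mfderiv (𝓡∂ n) 𝓘(ℝ, EuclideanSpace ℝ (Fin n)) (extChartAt (𝓡∂ n) p)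
    ((extChartAt (𝓡∂ n) p).symm y) (chartVec p y v) = 0
  rw [show chartVec p y v = 0 from h, map_zero]

theorem contDiffOn_metricCoord (g : Metric n M) (p : M) (v w : EuclideanSpace ℝ (Fin n)) :
    ContDiffOn ℝ ∞ (metricCoord g p v w) (extChartAt (𝓡∂ n) p).target := by
  have hsymm := contMDiffOn_extChartAt_symm (I := 𝓡∂ n) (n := ∞) p
  have ht := hsymm.contMDiffOn_tangentMapWithin (m := ∞) (by simp)
    (uniqueDiffOn_extChartAt_target p).uniqueMDiffOn
  have hconst : ∀ v : EuclideanSpace ℝ (Fin n), ContMDiffOn 𝓘(ℝ, EuclideanSpace ℝ (Fin n))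
      (𝓘(ℝ, EuclideanSpace ℝ (Fin n)).prod 𝓘(ℝ, EuclideanSpace ℝ (Fin n))) ∞
      (fun y => (⟨y, v⟩ : TangentBundle 𝓘(ℝ, EuclideanSpace ℝ (Fin n)) (EuclideanSpace ℝ (Fin n))))
      (extChartAt (𝓡∂ n) p).target := fun v =>
    contMDiffOn_vectorSpace_iff_contDiffOn.2 contDiffOn_const
  have hvec : ∀ v : EuclideanSpace ℝ (Fin n), ContMDiffOn 𝓘(ℝ, EuclideanSpace ℝ (Fin n))
      ((𝓡∂ n).prod 𝓘(ℝ, EuclideanSpace ℝ (Fin n))) ∞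
      (fun y => TotalSpace.mk' (EuclideanSpace ℝ (Fin n)) (E := fun x : M => TangentSpace (𝓡∂ n) x)
        ((extChartAt (𝓡∂ n) p).symm y) (chartVec p y v)) (extChartAt (𝓡∂ n) p).target := by
    intro v
    refine (ht.comp (hconst v) fun y hy => hy).congr fun y hy => ?_
    have h1 : mfderivWithin 𝓘(ℝ, EuclideanSpace ℝ (Fin n)) (𝓡∂ n) (extChartAt (𝓡∂ n) p).symm
        (extChartAt (𝓡∂ n) p).target y = chartVec p y :=
      (mdifferentiableWithinAt_extChartAt_symm hy).mfderivWithin_mono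
        ((uniqueDiffOn_extChartAt_target p).uniqueMDiffOn y hy) (extChartAt_target_subset_range p)
    simp only [Function.comp_def, tangentMapWithin, h1]
    rfl
  have hg : ContMDiffOn 𝓘(ℝ, EuclideanSpace ℝ (Fin n)) ((𝓡∂ n).prod
      𝓘(ℝ, EuclideanSpace ℝ (Fin n) →L[ℝ] EuclideanSpace ℝ (Fin n) →L[ℝ] ℝ)) ∞
      (fun y => TotalSpace.mk' (EuclideanSpace ℝ (Fin n) →L[ℝ] EuclideanSpace ℝ (Fin n) →L[ℝ] ℝ)
        (E := fun x : M => TangentSpace (𝓡∂ n) x →L[ℝ] TangentSpace (𝓡∂ n) x →L[ℝ] ℝ)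
        ((extChartAt (𝓡∂ n) p).symm y) (g.inner ((extChartAt (𝓡∂ n) p).symm y)))
      (extChartAt (𝓡∂ n) p).target := g.contMDiff.comp_contMDiffOn hsymm
  have key : ContMDiffOn 𝓘(ℝ, EuclideanSpace ℝ (Fin n)) ((𝓡∂ n).prod 𝓘(ℝ, ℝ)) ∞
      (fun y => TotalSpace.mk' ℝ (E := Bundle.Trivial M ℝ) ((extChartAt (𝓡∂ n) p).symm y)
        (metricCoord g p v w y)) (extChartAt (𝓡∂ n) p).target :=
    ContMDiffOn.clm_bundle_apply₂ (F₁ := EuclideanSpace ℝ (Fin n))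
      (F₂ := EuclideanSpace ℝ (Fin n)) (E₃ := Bundle.Trivial M ℝ) hg (hvec v) (hvec w)
  intro y hy
  have := key y hy
  simp only [contMDiffWithinAt_totalSpace] at this
  exact this.2.contDiffWithinAt

theorem contDiffOn_metricForm (g : Metric n M) (p : M) :
    ContDiffOn ℝ ∞ (metricForm g p) (extChartAt (𝓡∂ n) p).target :=
  contDiffOn_clm_apply.2 fun v => contDiffOn_clm_apply.2 fun w => contDiffOn_metricCoord g p v w

theorem contDiffWithinAt_metricForm (g : Metric n M) {p : M} {y : EuclideanSpace ℝ (Fin n)}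
    (hy : y ∈ (extChartAt (𝓡∂ n) p).target) :
    ContDiffWithinAt ℝ ∞ (metricForm g p) (range (𝓡∂ n)) y :=
  (contDiffOn_metricForm g p y hy).mono_of_mem_nhdsWithin
    (extChartAt_target_mem_nhdsWithin_of_mem hy)

theorem hasFDerivWithinAt_metricForm (g : Metric n M) {p : M} {y : EuclideanSpace ℝ (Fin n)}
    (hy : y ∈ (extChartAt (𝓡∂ n) p).target) :
    HasFDerivWithinAt (metricForm g p) (fderivWithin ℝ (metricForm g p) (range (𝓡∂ n)) y)
      (range (𝓡∂ n)) y :=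
  ((contDiffWithinAt_metricForm g hy).differentiableWithinAt (by simp)).hasFDerivWithinAt

theorem contDiffWithinAt_chartChange {a b : M} {y : EuclideanSpace ℝ (Fin n)}
    (hy : y ∈ (extChartAt (𝓡∂ n) a).target)
    (hb : (extChartAt (𝓡∂ n) a).symm y ∈ (extChartAt (𝓡∂ n) b).source) :
    ContDiffWithinAt ℝ ∞ (chartChange a b) (range (𝓡∂ n)) y :=
  contDiffWithinAt_ext_coord_change b a ⟨hy, hb⟩

theorem hasFDerivWithinAt_chartChange {a b : M} {y : EuclideanSpace ℝ (Fin n)}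
    (hy : y ∈ (extChartAt (𝓡∂ n) a).target)
    (hb : (extChartAt (𝓡∂ n) a).symm y ∈ (extChartAt (𝓡∂ n) b).source) :
    HasFDerivWithinAt (chartChange a b) (chartChangeDeriv a b y) (range (𝓡∂ n)) y :=
  ((contDiffWithinAt_chartChange hy hb).differentiableWithinAt (by simp)).hasFDerivWithinAt

theorem uniqueDiffOn_range_halfSpace :
    UniqueDiffOn ℝ (range (𝓡∂ n)) := (𝓡∂ n).uniqueDiffOn

theorem chartChangeDeriv_chartChangeDeriv {a b q : M} (ha : q ∈ (extChartAt (𝓡∂ n) a).source)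
    (hb : q ∈ (extChartAt (𝓡∂ n) b).source) (v : EuclideanSpace ℝ (Fin n)) :
    chartChangeDeriv b a (extChartAt (𝓡∂ n) b q)
      (chartChangeDeriv a b (extChartAt (𝓡∂ n) a q) v) = v := by
  have h1 := hasFDerivWithinAt_chartChange (b := b) ((extChartAt (𝓡∂ n) a).map_source ha)
    (by rwa [(extChartAt (𝓡∂ n) a).left_inv ha])
  have h2 := hasFDerivWithinAt_chartChange (b := a) ((extChartAt (𝓡∂ n) b).map_source hb)
    (by rwa [(extChartAt (𝓡∂ n) b).left_inv hb])
  rw [← chartChange_extChartAt b ha] at h2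
  have h3 := h2.comp _ h1 (chartChange_mapsTo a b)
  have h4 : HasFDerivWithinAt (chartChange b a ∘ chartChange a b)
      (ContinuousLinearMap.id ℝ (EuclideanSpace ℝ (Fin n))) (range (𝓡∂ n))
      (extChartAt (𝓡∂ n) a q) := by
    have hev : chartChange b a ∘ chartChange a b =ᶠ[𝓝[range (𝓡∂ n)] (extChartAt (𝓡∂ n) a q)] id := by
      filter_upwards [eventually_mem_overlap ha hb] with y hy
      simp only [chartChange, Function.comp_apply, id]
      rw [(extChartAt (𝓡∂ n) b).left_inv hy.2, (extChartAt (𝓡∂ n) a).right_inv hy.1]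
    exact (hasFDerivWithinAt_id _ _).congr_of_eventuallyEq hev
      (hev.eq_of_nhdsWithin (extChartAt_mem_range a q))
  have h5 := DFunLike.congr_fun
    ((uniqueDiffOn_range_halfSpace _ (extChartAt_mem_range a q)).eq h3 h4) v
  rw [← chartChange_extChartAt b ha]
  exact h5

/-- Changes of coordinates preserve the vectors that do not point outward. -/
theorem chartChangeDeriv_apply_zero_nonneg {a b q : M} (ha : q ∈ (extChartAt (𝓡∂ n) a).source)
    (hb : q ∈ (extChartAt (𝓡∂ n) b).source) (hq : q ∈ (𝓡∂ n).boundary M)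
    {v : EuclideanSpace ℝ (Fin n)} (hv : 0 ≤ v 0) :
    0 ≤ chartChangeDeriv a b (extChartAt (𝓡∂ n) a q) v 0 := by
  have h1 := hasFDerivWithinAt_chartChange (b := b) ((extChartAt (𝓡∂ n) a).map_source ha)
    (by rwa [(extChartAt (𝓡∂ n) a).left_inv ha])
  have h2 := (EuclideanSpace.proj (𝕜 := ℝ) (0 : Fin n)).hasFDerivAt.comp_hasFDerivWithinAt _ h1
  refine hasFDerivWithinAt_nonneg_of_eventually_le (𝓡∂ n).convex_range
    (extChartAt_mem_range a q) ?_ h2 ?_ (w := v)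
  · rw [mem_range_halfSpace_iff, PiLp.add_apply]
    exact add_nonneg (mem_range_halfSpace_iff.1 (extChartAt_mem_range a q)) hv
  -- Coordinate `0` of the chart change is nonnegative on the half-space and vanishes at the
  -- boundary point, which is therefore a minimum.
  · refine Eventually.of_forall fun y => ?_
    have h3 : chartChange a b (extChartAt (𝓡∂ n) a q) 0 = 0 := by
      rw [chartChange_extChartAt b ha]
      exact (mem_boundary_iff_extChartAt_apply_zero hb).1 hq
    change chartChange a b (extChartAt (𝓡∂ n) a q) 0 ≤ chartChange a b y 0
    rw [h3]
    exact mem_range_halfSpace_iff.1 (extChartAt_mem_range b _)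

/-- Changes of coordinates preserve the vectors tangent to the boundary. -/
theorem chartChangeDeriv_apply_zero_eq_zero {a b q : M} (ha : q ∈ (extChartAt (𝓡∂ n) a).source)
    (hb : q ∈ (extChartAt (𝓡∂ n) b).source) (hq : q ∈ (𝓡∂ n).boundary M)
    {v : EuclideanSpace ℝ (Fin n)} (hv : v 0 = 0) :
    chartChangeDeriv a b (extChartAt (𝓡∂ n) a q) v 0 = 0 := by
  refine le_antisymm ?_ (chartChangeDeriv_apply_zero_nonneg ha hb hq hv.ge)
  have := chartChangeDeriv_apply_zero_nonneg ha hb hq (v := -v) (by simp [hv])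
  simpa using this

/-- Changes of coordinates preserve the vectors pointing inward. -/
theorem chartChangeDeriv_apply_zero_pos {a b q : M} (ha : q ∈ (extChartAt (𝓡∂ n) a).source)
    (hb : q ∈ (extChartAt (𝓡∂ n) b).source) (hq : q ∈ (𝓡∂ n).boundary M)
    {v : EuclideanSpace ℝ (Fin n)} (hv : 0 < v 0) :
    0 < chartChangeDeriv a b (extChartAt (𝓡∂ n) a q) v 0 := by
  refine lt_of_le_of_ne (chartChangeDeriv_apply_zero_nonneg ha hb hq hv.le) fun h => hv.ne' ?_
  rw [← chartChangeDeriv_chartChangeDeriv ha hb v]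
  exact chartChangeDeriv_apply_zero_eq_zero hb ha hq h.symm

theorem chartVec_eq_chartVec_chartChangeDeriv {a b : M} {y : EuclideanSpace ℝ (Fin n)}
    (hy : y ∈ (extChartAt (𝓡∂ n) a).target)
    (hb : (extChartAt (𝓡∂ n) a).symm y ∈ (extChartAt (𝓡∂ n) b).source)
    (v : EuclideanSpace ℝ (Fin n)) :
    (chartVec a y v : EuclideanSpace ℝ (Fin n)) =
      chartVec b (chartChange a b y) (chartChangeDeriv a b y v) := by
  have hyr := extChartAt_target_subset_range (I := 𝓡∂ n) a hy
  have htgt : chartChange a b y ∈ (extChartAt (𝓡∂ n) b).target :=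
    (extChartAt (𝓡∂ n) b).map_source hb
  have hcomp := mfderivWithin_comp (I := 𝓘(ℝ, EuclideanSpace ℝ (Fin n)))
    (I' := 𝓘(ℝ, EuclideanSpace ℝ (Fin n))) (I'' := 𝓡∂ n) y
    (mdifferentiableWithinAt_extChartAt_symm htgt)
    (hasFDerivWithinAt_chartChange hy hb).hasMFDerivWithinAt.mdifferentiableWithinAt
    (chartChange_mapsTo a b) (uniqueDiffOn_range_halfSpace y hyr).uniqueMDiffWithinAt
  have hev : ((extChartAt (𝓡∂ n) b).symm ∘ chartChange a b) =ᶠ[𝓝[range (𝓡∂ n)] y]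
      (extChartAt (𝓡∂ n) a).symm := by
    have := eventually_mem_overlap (b := b) ((extChartAt (𝓡∂ n) a).map_target hy) hb
    rw [(extChartAt (𝓡∂ n) a).right_inv hy] at this
    filter_upwards [this] with z hz
    exact (extChartAt (𝓡∂ n) b).left_inv hz.2
  have h1 := hev.mfderivWithin_eq_of_mem (I := 𝓘(ℝ, EuclideanSpace ℝ (Fin n))) (I' := 𝓡∂ n) hyr
  have h2 := DFunLike.congr_fun (h1.symm.trans hcomp) v
  have h3 : mfderivWithin 𝓘(ℝ, EuclideanSpace ℝ (Fin n)) 𝓘(ℝ, EuclideanSpace ℝ (Fin n))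
    (chartChange a b) (range (𝓡∂ n)) y = chartChangeDeriv a b y := mfderivWithin_eq_fderivWithin
  rw [h3] at h2
  exact h2

theorem metricCoord_eq_chartChange (g : Metric n M) {a b : M} {y : EuclideanSpace ℝ (Fin n)}
    (hy : y ∈ (extChartAt (𝓡∂ n) a).target)
    (hb : (extChartAt (𝓡∂ n) a).symm y ∈ (extChartAt (𝓡∂ n) b).source)
    (v w : EuclideanSpace ℝ (Fin n)) :
    metricCoord g a v w y = metricForm g b (chartChange a b y) (chartChangeDeriv a b y v)
      (chartChangeDeriv a b y w) := by
  have h0 : (extChartAt (𝓡∂ n) b).symm (chartChange a b y) = (extChartAt (𝓡∂ n) a).symm y :=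
    (extChartAt (𝓡∂ n) b).left_inv hb
  -- Every tangent space is the model space by definition; forgetting the dependence on the base
  -- point allows rewriting along `h0`.
  let G : M → EuclideanSpace ℝ (Fin n) → EuclideanSpace ℝ (Fin n) → ℝ := fun q v w => g.inner q v w
  change G ((extChartAt (𝓡∂ n) a).symm y) (chartVec a y v) (chartVec a y w) =
    G ((extChartAt (𝓡∂ n) b).symm (chartChange a b y))
      (chartVec b (chartChange a b y) (chartChangeDeriv a b y v))
      (chartVec b (chartChange a b y) (chartChangeDeriv a b y w))
  rw [h0]
  exact congrArg₂ (G ((extChartAt (𝓡∂ n) a).symm y))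
    (chartVec_eq_chartVec_chartChangeDeriv hy hb v) (chartVec_eq_chartVec_chartChangeDeriv hy hb w)

end Manifold

/-! ### Chart independence and conformal change of the second fundamental form. -/

section SecondFundamentalForm

open Filter Topology

variable {n : ℕ} [NeZero n] {M : Type*} [TopologicalSpace M]
  [ChartedSpace (EuclideanHalfSpace n) M] [IsManifold (𝓡∂ n) ∞ M]

theorem contDiffWithinAt_chartChangeDeriv {a b q : M} (ha : q ∈ (extChartAt (𝓡∂ n) a).source)
    (hb : q ∈ (extChartAt (𝓡∂ n) b).source) :
    ContDiffWithinAt ℝ ∞ (chartChangeDeriv a b) (range (𝓡∂ n)) (extChartAt (𝓡∂ n) a q) :=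
  (contDiffWithinAt_chartChange ((extChartAt (𝓡∂ n) a).map_source ha)
    (by rwa [(extChartAt (𝓡∂ n) a).left_inv ha])).fderivWithin_right uniqueDiffOn_range_halfSpace
    (by simp) (extChartAt_mem_range a q)

/-- The second derivative of the change of coordinates between preferred charts. -/
abbrev chartChangeDeriv₂ (a b : M) (y : EuclideanSpace ℝ (Fin n)) :
    EuclideanSpace ℝ (Fin n) →L[ℝ] EuclideanSpace ℝ (Fin n) →L[ℝ] EuclideanSpace ℝ (Fin n) :=
  fderivWithin ℝ (chartChangeDeriv a b) (range (𝓡∂ n)) y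

theorem hasFDerivWithinAt_chartChangeDeriv {a b q : M} (ha : q ∈ (extChartAt (𝓡∂ n) a).source)
    (hb : q ∈ (extChartAt (𝓡∂ n) b).source) :
    HasFDerivWithinAt (chartChangeDeriv a b) (chartChangeDeriv₂ a b (extChartAt (𝓡∂ n) a q))
      (range (𝓡∂ n)) (extChartAt (𝓡∂ n) a q) :=
  ((contDiffWithinAt_chartChangeDeriv ha hb).differentiableWithinAt (by simp)).hasFDerivWithinAt

theorem chartChangeDeriv₂_symm {a b q : M} (ha : q ∈ (extChartAt (𝓡∂ n) a).source)
    (hb : q ∈ (extChartAt (𝓡∂ n) b).source) (v w : EuclideanSpace ℝ (Fin n)) :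
    chartChangeDeriv₂ a b (extChartAt (𝓡∂ n) a q) v w =
      chartChangeDeriv₂ a b (extChartAt (𝓡∂ n) a q) w v :=
  (contDiffWithinAt_chartChange ((extChartAt (𝓡∂ n) a).map_source ha)
    (by rwa [(extChartAt (𝓡∂ n) a).left_inv ha])).isSymmSndFDerivWithinAt
    (by simp only [minSmoothness_of_isRCLikeNormedField]; exact ENat.LEInfty.out)
    uniqueDiffOn_range_halfSpace
    ((𝓡∂ n).range_subset_closure_interior (extChartAt_mem_range a q)) (extChartAt_mem_range a q) v w

/-- Along a line in `{y | y 0 = 0}` the chart change stays in this hyperplane, so its second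
derivative is tangent to the boundary. Pairing with a normal vector then kills this correction in
the Christoffel symbols. -/
theorem chartChangeDeriv₂_apply_zero {a b q : M} (ha : q ∈ (extChartAt (𝓡∂ n) a).source)
    (hb : q ∈ (extChartAt (𝓡∂ n) b).source) (hq : q ∈ (𝓡∂ n).boundary M)
    {v : EuclideanSpace ℝ (Fin n)} (hv : v 0 = 0) :
    chartChangeDeriv₂ a b (extChartAt (𝓡∂ n) a q) v v 0 = 0 := by
  have hq0 := (mem_boundary_iff_extChartAt_apply_zero ha).1 hq
  have hline : ∀ t : ℝ, (extChartAt (𝓡∂ n) a q + t • v) 0 = 0 := fun t => by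
    rw [PiLp.add_apply, PiLp.smul_apply, hv, hq0, smul_zero, add_zero]
  refine apply_secondDeriv_eq_zero (EuclideanSpace.proj (𝕜 := ℝ) (0 : Fin n))
    (σ := chartChange a b) (σ' := chartChangeDeriv a b)
    (fun t => mem_range_halfSpace_iff.2 (hline t).ge) ?_ (hasFDerivWithinAt_chartChangeDeriv ha hb) ?_
  · filter_upwards [eventually_mem_overlap ha hb] with y hy
    exact hasFDerivWithinAt_chartChange hy.1 hy.2
  · filter_upwards [eventually_mem_overlap ha hb] with y hy t ht
    have h1 : (extChartAt (𝓡∂ n) a).symm y ∈ (𝓡∂ n).boundary M := by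
      rw [mem_boundary_iff_extChartAt_apply_zero ((extChartAt (𝓡∂ n) a).map_target hy.1),
        (extChartAt (𝓡∂ n) a).right_inv hy.1, ht]
      exact hline t
    exact (mem_boundary_iff_extChartAt_apply_zero hy.2).1 h1

/-- The derivative of the metric tensor in the preferred chart at `p`. -/
abbrev metricFormDeriv (g : Metric n M) (p : M) (y : EuclideanSpace ℝ (Fin n)) :
    EuclideanSpace ℝ (Fin n) →L[ℝ] EuclideanSpace ℝ (Fin n) →L[ℝ] EuclideanSpace ℝ (Fin n) →L[ℝ] ℝ :=
  fderivWithin ℝ (metricForm g p) (range (𝓡∂ n)) y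

/-- Product rule for the pulled-back tensor; the two `D₂` terms are the non-tensorial part of the
transformation law. -/
theorem dMetricCoord_eq_chartChange (g : Metric n M) {x p : M}
    (hp : x ∈ (extChartAt (𝓡∂ n) p).source) (u v w : EuclideanSpace ℝ (Fin n)) :
    letI z := extChartAt (𝓡∂ n) x x
    letI y := extChartAt (𝓡∂ n) p x
    letI D := chartChangeDeriv x p z
    letI D₂ := chartChangeDeriv₂ x p z
    dMetricCoord g x u v w = metricFormDeriv g p y (D u) (D v) (D w) +
      metricForm g p y (D₂ u v) (D w) + metricForm g p y (D v) (D₂ u w) := by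
  have hx := mem_extChartAt_source (I := 𝓡∂ n) x
  have hz := extChartAt_mem_range (n := n) x x
  have hy := chartChange_extChartAt p hx
  have hσ := hasFDerivWithinAt_chartChange (b := p) ((extChartAt (𝓡∂ n) x).map_source hx)
    (by rwa [(extChartAt (𝓡∂ n) x).left_inv hx])
  have hG := hasFDerivWithinAt_metricForm g ((extChartAt (𝓡∂ n) p).map_source hp)
  rw [← hy] at hG ⊢
  have hD := hasFDerivWithinAt_chartChangeDeriv hx hp
  have hGσ := hG.comp _ hσ (chartChange_mapsTo x p)
  have hv := hD.clm_apply (hasFDerivWithinAt_const v _ _)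
  have hw := hD.clm_apply (hasFDerivWithinAt_const w _ _)
  have hall := (hGσ.clm_apply hv).clm_apply hw
  have hev : metricCoord g x v w =ᶠ[𝓝[range (𝓡∂ n)] (extChartAt (𝓡∂ n) x x)] fun y =>
      (metricForm g p ∘ chartChange x p) y (chartChangeDeriv x p y v) (chartChangeDeriv x p y w) := by
    filter_upwards [eventually_mem_overlap hx hp] with y hy
    exact metricCoord_eq_chartChange g hy.1 hy.2 v w
  have := (hall.congr_of_eventuallyEq hev (hev.eq_of_nhdsWithin hz)).fderivWithin
    (uniqueDiffOn_range_halfSpace _ hz)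
  unfold dMetricCoord
  rw [this]
  simp only [add_apply, ContinuousLinearMap.comp_apply, ContinuousLinearMap.flip_apply,
    zero_apply, map_zero, zero_add, Function.comp_apply]
  ring

/-- The Christoffel symbols entering the second fundamental form do not depend on the chart. -/
theorem christoffel_eq_chartChange (g : Metric n M) {x p : M} (hb : x ∈ (𝓡∂ n).boundary M)
    (hp : x ∈ (extChartAt (𝓡∂ n) p).source) {u w : EuclideanSpace ℝ (Fin n)} (hu : u 0 = 0)
    (hw : ∀ v : EuclideanSpace ℝ (Fin n), v 0 = 0 →
      metricForm g p (extChartAt (𝓡∂ n) p x)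
        (chartChangeDeriv x p (extChartAt (𝓡∂ n) x x) w) v = 0) :
    letI y := extChartAt (𝓡∂ n) p x
    letI D := chartChangeDeriv x p (extChartAt (𝓡∂ n) x x)
    christoffel g x u u w = (metricFormDeriv g p y (D u) (D u) (D w) +
      metricFormDeriv g p y (D u) (D u) (D w) - metricFormDeriv g p y (D w) (D u) (D u)) / 2 := by
  have hx := mem_extChartAt_source (I := 𝓡∂ n) x
  have h0 := hw _ (chartChangeDeriv₂_apply_zero hx hp hb hu)
  rw [metricForm_symm] at h0
  unfold christoffel
  -- The terms `D₂ u u` vanish by `h0`; the mixed terms `D₂ u w` cancel against `D₂ w u` by symmetry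
  -- of the second derivative.
  rw [dMetricCoord_eq_chartChange g hp u u w, dMetricCoord_eq_chartChange g hp w u u,
    chartChangeDeriv₂_symm hx hp w u, h0,
    metricForm_symm g p _ (chartChangeDeriv x p (extChartAt (𝓡∂ n) x x) u)]
  ring

theorem hasFDerivWithinAt_comp_extChartAt_symm {φ : M → ℝ} (hφ : ContMDiff (𝓡∂ n) 𝓘(ℝ, ℝ) ∞ φ)
    (x : M) : HasFDerivWithinAt (φ ∘ (extChartAt (𝓡∂ n) x).symm)
      (fderivWithin ℝ (φ ∘ (extChartAt (𝓡∂ n) x).symm) (range (𝓡∂ n)) (extChartAt (𝓡∂ n) x x))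
      (range (𝓡∂ n)) (extChartAt (𝓡∂ n) x x) := by
  have h1 := hφ.comp_contMDiffOn (contMDiffOn_extChartAt_symm (I := 𝓡∂ n) (n := ∞) x)
  have h2 := (h1 _ (mem_extChartAt_target x)).contDiffWithinAt.mono_of_mem_nhdsWithin
    (extChartAt_target_mem_nhdsWithin x)
  exact (h2.differentiableWithinAt (by simp)).hasFDerivWithinAt

theorem dMetricCoord_conformal (g : Metric n M) {φ : M → ℝ}
    (hφ : ContMDiff (𝓡∂ n) 𝓘(ℝ, ℝ) ∞ φ) (hpos : ∀ x, 0 < φ x) (x : M)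
    (u v w : EuclideanSpace ℝ (Fin n)) :
    dMetricCoord (g.conformal φ hφ hpos) x u v w = φ x * dMetricCoord g x u v w +
      fderivWithin ℝ (φ ∘ (extChartAt (𝓡∂ n) x).symm) (range (𝓡∂ n)) (extChartAt (𝓡∂ n) x x) u *
        metricForm g x (extChartAt (𝓡∂ n) x x) v w := by
  have hz := extChartAt_mem_range (n := n) x x
  have h1 : HasFDerivWithinAt (metricCoord g x v w) _ _ _ :=
    (((contDiffOn_metricCoord g x v w _ (mem_extChartAt_target x)).mono_of_mem_nhdsWithin
      (extChartAt_target_mem_nhdsWithin x)).differentiableWithinAt (by simp)).hasFDerivWithinAt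
  have h2 := ((hasFDerivWithinAt_comp_extChartAt_symm hφ x).mul h1).fderivWithin
    (uniqueDiffOn_range_halfSpace _ hz)
  change fderivWithin ℝ ((φ ∘ (extChartAt (𝓡∂ n) x).symm) * metricCoord g x v w) _ _ u = _
  rw [h2]
  simp only [add_apply, smul_apply, smul_eq_mul, Function.comp_apply, extChartAt_to_inv,
    metricForm_apply, dMetricCoord]
  ring

/-- Orthogonality of `u` and `w` removes the two terms in which `φ` is differentiated along `u`. -/
theorem christoffel_conformal (g : Metric n M) {φ : M → ℝ}
    (hφ : ContMDiff (𝓡∂ n) 𝓘(ℝ, ℝ) ∞ φ) (hpos : ∀ x, 0 < φ x) (x : M)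
    {u w : EuclideanSpace ℝ (Fin n)} (huw : metricForm g x (extChartAt (𝓡∂ n) x x) u w = 0) :
    christoffel (g.conformal φ hφ hpos) x u u w = φ x * christoffel g x u u w -
      fderivWithin ℝ (φ ∘ (extChartAt (𝓡∂ n) x).symm) (range (𝓡∂ n)) (extChartAt (𝓡∂ n) x x) w *
        metricForm g x (extChartAt (𝓡∂ n) x x) u u / 2 := by
  unfold christoffel
  rw [dMetricCoord_conformal, dMetricCoord_conformal, huw]
  ring

theorem metricForm_coordVec (g : Metric n M) (x : M) (v w : TangentSpace (𝓡∂ n) x) :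
    metricForm g x (extChartAt (𝓡∂ n) x x) (coordVec x v) (coordVec x w) = g.inner x v w := by
  have h := mfderivWithin_extChartAt_symm_comp_mfderiv_extChartAt' (I := 𝓡∂ n)
    (mem_extChartAt_source (I := 𝓡∂ n) x)
  have hv : ∀ v : TangentSpace (𝓡∂ n) x, (chartVec x (extChartAt (𝓡∂ n) x x) (coordVec x v) :
      EuclideanSpace ℝ (Fin n)) = v := fun v => DFunLike.congr_fun h v
  let G : M → EuclideanSpace ℝ (Fin n) → EuclideanSpace ℝ (Fin n) → ℝ := fun q v w => g.inner q v w
  change G ((extChartAt (𝓡∂ n) x).symm (extChartAt (𝓡∂ n) x x))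
    (chartVec x (extChartAt (𝓡∂ n) x x) (coordVec x v))
    (chartVec x (extChartAt (𝓡∂ n) x x) (coordVec x w)) = G x v w
  rw [extChartAt_to_inv]
  exact congrArg₂ (G x) (hv v) (hv w)

theorem coordVec_surjective (x : M) : Function.Surjective (coordVec (n := n) x) := by
  obtain ⟨e, he⟩ := isInvertible_mfderiv_extChartAt (I := 𝓡∂ n) (mem_extChartAt_source (I := 𝓡∂ n) x)
  unfold coordVec
  rw [← he]
  exact e.surjective

theorem coordVec_injective (x : M) : Function.Injective (coordVec (n := n) x) := by
  obtain ⟨e, he⟩ := isInvertible_mfderiv_extChartAt (I := 𝓡∂ n) (mem_extChartAt_source (I := 𝓡∂ n) x)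
  unfold coordVec
  rw [← he]
  exact e.injective

theorem isInwardUnitNormal_inwardUnitNormal (g : Metric n M) (x : M) :
    IsInwardUnitNormal g x (inwardUnitNormal g x) :=
  Classical.choose_spec (exists_isInwardUnitNormal g x)

/-- A vector of the preferred chart at `x` that is normal to the boundary is mapped to such a
vector by a change of coordinates. -/
theorem metricForm_chartChangeDeriv_eq_zero (g : Metric n M) {x p : M}
    (hb : x ∈ (𝓡∂ n).boundary M) (hp : x ∈ (extChartAt (𝓡∂ n) p).source)
    {w : EuclideanSpace ℝ (Fin n)}
    (hw : ∀ v : EuclideanSpace ℝ (Fin n), v 0 = 0 →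
      metricForm g x (extChartAt (𝓡∂ n) x x) w v = 0)
    {v : EuclideanSpace ℝ (Fin n)} (hv : v 0 = 0) :
    metricForm g p (extChartAt (𝓡∂ n) p x)
      (chartChangeDeriv x p (extChartAt (𝓡∂ n) x x) w) v = 0 := by
  have hx := mem_extChartAt_source (I := 𝓡∂ n) x
  have h1 := hw _ (chartChangeDeriv_apply_zero_eq_zero hp hx hb hv)
  rwa [metricForm_apply, metricCoord_eq_chartChange g (b := p) (mem_extChartAt_target x)
    (by rwa [extChartAt_to_inv]), chartChange_extChartAt p hx,
    chartChangeDeriv_chartChangeDeriv hp hx] at h1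

/-- A criterion for the positivity of the second fundamental form of a conformal metric, in terms of
an auxiliary chart. -/
theorem secondFundamentalForm_conformal_pos (g : Metric n M) {φ : M → ℝ}
    (hφ : ContMDiff (𝓡∂ n) 𝓘(ℝ, ℝ) ∞ φ) (hpos : ∀ x, 0 < φ x) {x p : M}
    (hb : x ∈ (𝓡∂ n).boundary M) (hp : x ∈ (extChartAt (𝓡∂ n) p).source) {K : ℝ}
    (hK : ∀ a b : EuclideanSpace ℝ (Fin n), a ≠ 0 → 0 < b 0 →
      (∀ v : EuclideanSpace ℝ (Fin n), v 0 = 0 →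
        metricForm g p (extChartAt (𝓡∂ n) p x) b v = 0) →
      0 < 2 * ((metricFormDeriv g p (extChartAt (𝓡∂ n) p x) a a b +
        metricFormDeriv g p (extChartAt (𝓡∂ n) p x) a a b -
        metricFormDeriv g p (extChartAt (𝓡∂ n) p x) b a a) / 2) +
        K / 2 * b 0 * metricForm g p (extChartAt (𝓡∂ n) p x) a a)
    (hφx : φ x = 2)
    (hφ' : ∀ w : EuclideanSpace ℝ (Fin n), 0 < w 0 →
      fderivWithin ℝ (φ ∘ (extChartAt (𝓡∂ n) x).symm) (range (𝓡∂ n)) (extChartAt (𝓡∂ n) x x) w ≤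
        -(K * chartChangeDeriv x p (extChartAt (𝓡∂ n) x x) w 0))
    {v : TangentSpace (𝓡∂ n) x} (hv : coordVec x v 0 = 0) (hv0 : v ≠ 0) :
    0 < secondFundamentalForm (g.conformal φ hφ hpos) x v v := by
  have hx := mem_extChartAt_source (I := 𝓡∂ n) x
  have hν := isInwardUnitNormal_inwardUnitNormal (g.conformal φ hφ hpos) x
  unfold secondFundamentalForm
  set ν := inwardUnitNormal (g.conformal φ hφ hpos) x
  set w := coordVec x ν
  set u := coordVec x v
  have hu0 : u ≠ 0 := fun h => hv0 (coordVec_injective x (h.trans (map_zero _).symm))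
  have hnormal : ∀ v : EuclideanSpace ℝ (Fin n), v 0 = 0 →
      metricForm g x (extChartAt (𝓡∂ n) x x) w v = 0 := by
    intro v' hv'
    obtain ⟨v', rfl⟩ := coordVec_surjective x v'
    -- Conformal metrics have the same normal directions, so the unit normal of `φ g` is also
    -- `g`-normal.
    have h1 : φ x * g.inner x ν v' = 0 := hν.normal v' hv'
    rw [metricForm_coordVec]
    exact (mul_eq_zero.1 h1).resolve_left (hpos x).ne'
  have hnormal' := fun v hv => metricForm_chartChangeDeriv_eq_zero g hb hp hnormal (v := v) hv
  rw [christoffel_conformal g hφ hpos x (by rw [metricForm_symm]; exact hnormal u hv), hφx,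
    christoffel_eq_chartChange g hb hp hv hnormal']
  have h1 : metricForm g x (extChartAt (𝓡∂ n) x x) u u =
      metricForm g p (extChartAt (𝓡∂ n) p x) (chartChangeDeriv x p (extChartAt (𝓡∂ n) x x) u)
        (chartChangeDeriv x p (extChartAt (𝓡∂ n) x x) u) := by
    rw [metricForm_apply, metricCoord_eq_chartChange g (b := p) (mem_extChartAt_target x)
      (by rwa [extChartAt_to_inv]), chartChange_extChartAt p hx]
  have h2 := hφ' w hν.inward
  have hDu : chartChangeDeriv x p (extChartAt (𝓡∂ n) x x) u ≠ 0 := fun h => hu0 (by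
    rw [← chartChangeDeriv_chartChangeDeriv hx hp u, h, map_zero])
  have h3 := hK _ _ hDu (chartChangeDeriv_apply_zero_pos hx hp hb hν.inward) hnormal'
  have h4 := metricForm_pos g (mem_extChartAt_target (I := 𝓡∂ n) x) hu0
  have h5 := mul_le_mul_of_nonneg_right h2 h4.le
  rw [← h1] at h3
  linarith

end SecondFundamentalForm

/-! ### Construction of the conformal factor. -/

section Construction

open Filter Topology

variable {n : ℕ} [NeZero n] {M : Type*} [TopologicalSpace M]
  [ChartedSpace (EuclideanHalfSpace n) M] [IsManifold (𝓡∂ n) ∞ M]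

/-- The distance to `∂M` is at most the distance to the boundary point `x`, which is small near `x`
because the metric is continuous. -/
theorem boundaryNhd_mem_nhds (g : Metric n M) {t : ℝ} (ht : 0 < t) {x : M}
    (hx : x ∈ (𝓡∂ n).boundary M) : boundaryNhd g t ∈ 𝓝 x := by
  let : RiemannianBundle (fun x : M => TangentSpace (𝓡∂ n) x) := ⟨g.toRiemannianMetric⟩
  have : IsContinuousRiemannianBundle (EuclideanSpace ℝ (Fin n))
      (fun x : M => TangentSpace (𝓡∂ n) x) := ⟨⟨g.inner, g.contMDiff.continuous, fun _ _ _ => rfl⟩⟩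
  have : IsManifold (𝓡∂ n) 1 M := IsManifold.of_le (n := ∞) (by simp)
  filter_upwards [eventually_riemannianEDist_lt (𝓡∂ n) x (ENNReal.ofReal_pos.2 ht)] with y hy
  change (⨅ z ∈ (𝓡∂ n).boundary M, g.edist y z) < ENNReal.ofReal t
  refine lt_of_le_of_lt (iInf₂_le x hx) ?_
  change Manifold.riemannianEDist (𝓡∂ n) y x < _
  rwa [Manifold.riemannianEDist_comm]

/-- Keeping the chart at `p` fixed while `x` varies makes the coefficients continuous in `x`, so
that one `K` serves a whole neighbourhood. -/
theorem exists_eventually_christoffel_metricForm_pos (g : Metric n M) (p : M) :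
    ∃ K > 0, ∀ᶠ x in 𝓝 p, ∀ a b : EuclideanSpace ℝ (Fin n), a ≠ 0 → 0 < b 0 →
      (∀ v : EuclideanSpace ℝ (Fin n), v 0 = 0 →
        metricForm g p (extChartAt (𝓡∂ n) p x) b v = 0) →
      0 < 2 * ((metricFormDeriv g p (extChartAt (𝓡∂ n) p x) a a b +
        metricFormDeriv g p (extChartAt (𝓡∂ n) p x) a a b -
        metricFormDeriv g p (extChartAt (𝓡∂ n) p x) b a a) / 2) +
        K / 2 * b 0 * metricForm g p (extChartAt (𝓡∂ n) p x) a a := by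
  have hG := contDiffWithinAt_metricForm g (mem_extChartAt_target (I := 𝓡∂ n) p)
  have hG' := hG.fderivWithin_right (m := ∞) uniqueDiffOn_range_halfSpace (by simp)
    (extChartAt_mem_range p p)
  obtain ⟨K, hK, h⟩ := exists_eventually_christoffel_pos hG.continuousWithinAt
    hG'.continuousWithinAt (fun a ha => metricForm_pos g (mem_extChartAt_target (I := 𝓡∂ n) p) ha)
    (EuclideanSpace.proj (𝕜 := ℝ) (0 : Fin n)) (e := EuclideanSpace.single 0 1) (by simp)
  exact ⟨K, hK, (tendsto_nhdsWithin_iff.2 ⟨continuousAt_extChartAt p,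
    Eventually.of_forall (extChartAt_mem_range p)⟩).eventually h⟩

/-- There is a smooth nonnegative function that vanishes on the boundary and grows from there at any
prescribed locally bounded rate. -/
theorem exists_contMDiff_boundary_growth [T2Space M] [SigmaCompactSpace M] {K : M → ℝ}
    (hK : ∀ p, 0 < K p) {U : M → Set M} (hU : ∀ p ∈ (𝓡∂ n).boundary M, U p ∈ 𝓝 p) :
    ∃ θ : M → ℝ, ContMDiff (𝓡∂ n) 𝓘(ℝ, ℝ) ∞ θ ∧ (∀ x ∈ (𝓡∂ n).boundary M, θ x = 0) ∧
      ∀ x ∈ (𝓡∂ n).boundary M, ∃ p, x ∈ (extChartAt (𝓡∂ n) p).source ∧ x ∈ U p ∧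
        ∀ᶠ y in 𝓝 x, K p * extChartAt (𝓡∂ n) p y 0 ≤ θ y := by
  obtain ⟨ι, f, hf⟩ := SmoothBumpCovering.exists_isSubordinate (𝓡∂ n)
    ((𝓡∂ n).isClosed_boundary (M := M) (n := ∞) (by simp)) hU
  -- Each summand is nonnegative and vanishes on `∂M`. Near a boundary point some bump is
  -- identically `1`, so its summand alone gives the required growth.
  let F : ι → M → ℝ := fun i x => f i x • (K (f.c i) * extChartAt (𝓡∂ n) (f.c i) x 0)
  have hF : ∀ i, ContMDiff (𝓡∂ n) 𝓘(ℝ, ℝ) ∞ (F i) := fun i => by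
    refine (f i).contMDiff_smul ?_
    have h1 : ContDiff ℝ ∞ (fun y : EuclideanSpace ℝ (Fin n) => K (f.c i) * y 0) := by fun_prop
    exact h1.contMDiff.comp_contMDiffOn contMDiffOn_extChartAt
  have hlf : LocallyFinite fun i => Function.support (F i) :=
    f.locallyFinite.subset fun i => Function.support_smul_subset_left (f i) _
  have hnn : ∀ i x, 0 ≤ F i x := fun i x => mul_nonneg (f i).nonneg
    (mul_nonneg (hK _).le (mem_range_halfSpace_iff.1 (extChartAt_mem_range _ x)))
  refine ⟨fun x => ∑ᶠ i, F i x, contMDiff_finsum hF hlf, fun x hx => ?_, fun x hx => ?_⟩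
  · refine finsum_eq_zero_of_forall_eq_zero fun i => ?_
    by_cases h : f i x = 0
    · simp [F, h]
    · have hs : x ∈ (extChartAt (𝓡∂ n) (f.c i)).source := by
        rw [extChartAt_source]
        exact (f i).support_subset_source h
      change f i x • (K (f.c i) * extChartAt (𝓡∂ n) (f.c i) x 0) = 0
      rw [(mem_boundary_iff_extChartAt_apply_zero hs).1 hx, mul_zero, smul_zero]
  · refine ⟨f.c (f.ind x hx), f.mem_extChartAt_ind_source x hx,
      hf.support_subset _ (f.mem_support_ind x hx), ?_⟩
    filter_upwards [f.eventuallyEq_one x hx] with y hy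
    have h1 : F (f.ind x hx) y = K (f.c (f.ind x hx)) *
        extChartAt (𝓡∂ n) (f.c (f.ind x hx)) y 0 := by
      simp only [F, hy, Pi.one_apply, one_smul]
    rw [← h1]
    exact single_le_finsum (f := fun i => F i y) (f.ind x hx) (hlf.point_finite y)
      fun i => hnn i y

/-- The inward derivative at the boundary of a function lying below `1 + exp (-K y₀)`, where `y₀` is
the defining coordinate of the boundary in some chart. -/
theorem fderivWithin_comp_symm_le {φ θ : M → ℝ} (hφ : ContMDiff (𝓡∂ n) 𝓘(ℝ, ℝ) ∞ φ)
    (hle : ∀ x, φ x ≤ 1 + Real.exp (-θ x)) {x p : M} {K : ℝ} (hb : x ∈ (𝓡∂ n).boundary M)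
    (hp : x ∈ (extChartAt (𝓡∂ n) p).source) (hφx : φ x = 2)
    (hθ : ∀ᶠ y in 𝓝 x, K * extChartAt (𝓡∂ n) p y 0 ≤ θ y)
    {w : EuclideanSpace ℝ (Fin n)} (hw : 0 ≤ w 0) :
    fderivWithin ℝ (φ ∘ (extChartAt (𝓡∂ n) x).symm) (range (𝓡∂ n)) (extChartAt (𝓡∂ n) x x) w ≤
      -(K * chartChangeDeriv x p (extChartAt (𝓡∂ n) x x) w 0) := by
  have hx := mem_extChartAt_source (I := 𝓡∂ n) x
  have hz := extChartAt_mem_range (n := n) x x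
  have hσ := (EuclideanSpace.proj (𝕜 := ℝ) (0 : Fin n)).hasFDerivAt.comp_hasFDerivWithinAt _
    (hasFDerivWithinAt_chartChange (b := p) ((extChartAt (𝓡∂ n) x).map_source hx)
    (by rwa [(extChartAt (𝓡∂ n) x).left_inv hx]))
  have hσ0 : chartChange x p (extChartAt (𝓡∂ n) x x) 0 = 0 := by
    rw [chartChange_extChartAt p hx]
    exact (mem_boundary_iff_extChartAt_apply_zero hp).1 hb
  -- The difference `1 + exp (-K y₀) - φ` is zero at `x` and nonnegative nearby, hence has
  -- nonnegative derivative along `w`.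
  have hψ := ((hσ.const_mul K).neg.exp.const_add 1).sub
    (hasFDerivWithinAt_comp_extChartAt_symm hφ x)
  have hmin := hasFDerivWithinAt_nonneg_of_eventually_le (𝓡∂ n).convex_range hz (w := w) (by
    rw [mem_range_halfSpace_iff, PiLp.add_apply]
    exact add_nonneg (mem_range_halfSpace_iff.1 hz) hw) hψ (by
    have hc : Tendsto (extChartAt (𝓡∂ n) x).symm (𝓝[range (𝓡∂ n)] (extChartAt (𝓡∂ n) x x)) (𝓝 x) := by
      have := continuousAt_extChartAt_symm (I := 𝓡∂ n) x
      rw [ContinuousAt, extChartAt_to_inv] at this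
      exact this.mono_left inf_le_left
    filter_upwards [hc.eventually hθ] with y hy
    have h1 := hle ((extChartAt (𝓡∂ n) x).symm y)
    have h2 : Real.exp (-θ ((extChartAt (𝓡∂ n) x).symm y)) ≤
        Real.exp (-(K * chartChange x p y 0)) := Real.exp_le_exp.2 (neg_le_neg hy)
    change 1 + Real.exp (-(K * chartChange x p (extChartAt (𝓡∂ n) x x) 0)) -
      φ ((extChartAt (𝓡∂ n) x).symm (extChartAt (𝓡∂ n) x x)) ≤
      1 + Real.exp (-(K * chartChange x p y 0)) - φ ((extChartAt (𝓡∂ n) x).symm y)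
    rw [hσ0, extChartAt_to_inv, hφx, mul_zero, neg_zero, Real.exp_zero]
    linarith)
  have hval : Real.exp (-(K * chartChange x p (extChartAt (𝓡∂ n) x x) 0)) = 1 := by
    rw [hσ0, mul_zero, neg_zero, Real.exp_zero]
  change 0 ≤ Real.exp (-(K * chartChange x p (extChartAt (𝓡∂ n) x x) 0)) *
    -(K * chartChangeDeriv x p (extChartAt (𝓡∂ n) x x) w 0) -
    fderivWithin ℝ (φ ∘ (extChartAt (𝓡∂ n) x).symm) (range (𝓡∂ n)) (extChartAt (𝓡∂ n) x x) w
    at hmin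
  rw [hval] at hmin
  linarith

/-- Any Riemannian metric becomes strictly convex at the boundary after a conformal change
supported near the boundary. -/
theorem exists_conformal_hasConvexBoundary [T2Space M] [SigmaCompactSpace M] (g : Metric n M)
    {U : Set M} (hU : ∀ x ∈ (𝓡∂ n).boundary M, U ∈ 𝓝 x) :
    ∃ (φ : M → ℝ) (hφ : ContMDiff (𝓡∂ n) 𝓘(ℝ, ℝ) ∞ φ) (hφ_one : ∀ x, 1 ≤ φ x),
      HasConvexBoundary (g.conformal φ hφ (fun x => lt_of_lt_of_le one_pos (hφ_one x))) ∧
      ∀ x ∉ U, φ x = 1 := by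
  choose K hK hK' using exists_eventually_christoffel_metricForm_pos g
  obtain ⟨θ, hθ, hθ0, hθK⟩ := exists_contMDiff_boundary_growth (n := n) hK (fun p _ => hK' p)
  -- The two closed sets are the complement of the interior of `U` and `∂M`. It is enough that `χ =
  -- 1` on `∂M` itself, since only `χ ≤ 1` is needed nearby.
  obtain ⟨χ, hχ0, hχ1, hχ⟩ := exists_contMDiffMap_zero_one_of_isClosed (n := ⊤) (𝓡∂ n)
    (isOpen_interior (s := U)).isClosed_compl
    ((𝓡∂ n).isClosed_boundary (M := M) (n := ∞) (by simp))
    (disjoint_left.2 fun x hx hb => hx (mem_interior_iff_mem_nhds.2 (hU x hb)))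
  have hφ : ContMDiff (𝓡∂ n) 𝓘(ℝ, ℝ) ∞ fun x => 1 + χ x * Real.exp (-θ x) :=
    contMDiff_const.add (χ.contMDiff.mul ((Real.contDiff_exp.comp contDiff_neg).contMDiff.comp hθ))
  refine ⟨_, hφ, fun x => ?_, fun x hb v hv hv0 => ?_, fun x hx => ?_⟩
  · have := mul_nonneg (hχ x).1 (Real.exp_pos (-θ x)).le
    linarith
  · obtain ⟨p, hp, hpU, hpθ⟩ := hθK x hb
    have hφx : 1 + χ x * Real.exp (-θ x) = 2 := by
      rw [hχ1 hb, hθ0 x hb]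
      norm_num
    refine secondFundamentalForm_conformal_pos g hφ _ hb hp hpU hφx (fun w hw => ?_) hv hv0
    refine fderivWithin_comp_symm_le hφ (fun y => ?_) hb hp hφx hpθ hw.le
    have := mul_le_mul_of_nonneg_right (hχ y).2 (Real.exp_pos (-θ y)).le
    linarith
  · simp [hχ0 (fun h => hx (interior_subset h))]

end Construction

end BoundaryConvexity

end

theorem mainTheorem5 (n : ℕ) [NeZero n] (M : Type*) [TopologicalSpace M] [T2Space M]
    [SigmaCompactSpace M] [ChartedSpace (EuclideanHalfSpace n) M] [IsManifold (𝓡∂ n) ∞ M]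
    (g₀ : BoundaryConvexity.Metric n M) (t₀ : ℝ) (ht₀ : 0 < t₀)
    (hcollar : BoundaryConvexity.IsNormalCollar g₀ t₀) :
    ∃ (φ : M → ℝ) (hφ : ContMDiff (𝓡∂ n) 𝓘(ℝ, ℝ) ∞ φ) (hφ_one : ∀ x, 1 ≤ φ x),
      BoundaryConvexity.HasConvexBoundary
        (g₀.conformal φ hφ (fun x => lt_of_lt_of_le one_pos (hφ_one x))) ∧
      ∀ x ∉ BoundaryConvexity.boundaryNhd g₀ t₀, φ x = 1 :=
  BoundaryConvexity.exists_conformal_hasConvexBoundary g₀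
    fun _ hx => BoundaryConvexity.boundaryNhd_mem_nhds g₀ ht₀ hx
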